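/- **Conventions.** For a group $G$ let $G^{(k)}$ be its derived series and $G^{(k)}_r$ its rational derived series: $G^{(0)}_r=G$ and $G^{(k+1)}_r=\operatorname{Ker}\{G^{(k)}_r\to G^{(k)}_r/[G^{(k)}_r,G^{(k)}_r]\otimes_{\mathbb Z}\mathbb Q\}$. Put $G_k:=G/G^{(k)}_r$. Let $R=\mathbb Q$ or $R=\mathbb Z_p$ ($p$ a prime). The group ring $RG_k$ is an Ore domain; let $\mathbb K(G_k)=\mathbb K_R(G_k)$ be its skew quotient field. A homomorphism from a group $S$ to $G$ makes $RG_k$ and $\mathbb K(G_k)$ into coefficient systems for $S$, and $H_1(S;-)$ is group homology with these coefficients. **Definition.** Let $i\colon F\to S$ be a homomorphism of groups, where $F$ is free of rank $2g$, and suppose $H_1(S;R)\neq 0$. A nontrivial homomorphism $r\colon S\to G$ is an *$R$-algebraic $n$-solution* for $i$ if 1. for each $0\le k\le n-1$ the map $r_*\colon H_1(S;\mathbb K(G_k))\to H_1(G;\mathbb K(G_k))$ is nonzero, and 2. for each $0\le k\le n$ the map $i_*\colon H_1(F;\mathbb K(G_k))\to H_1(S;\mathbb K(G_k))$ is surjective.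 **Theorem.** Let $F$ be a free group of rank $2g$ and let $i\colon F\to S$ be a group homomorphism. For each $n\ge 0$ there exists a finite collection $\mathcal P_n$ of sets, each consisting of exactly $2g-1$ (if $n>0$) or $2g$ (if $n=0$) elements of $F^{(n)}$, with the following property (for $g=0$, $n>0$ read $2g-1$ as $0$). Let $p$ be a prime, $G$ a group and $r\colon S\to G$ a homomorphism which is an $R$-algebraic $n$-solution for $i$ for both $R=\mathbb Q$ and $R=\mathbb Z_p$. Then there is one element of $\mathcal P_n$ which, for both $R=\mathbb Q$ and $R=\mathbb Z_p$, maps to a generating set of the $\mathbb K(G_n)$-vector space $H_1(S;\mathbb K(G_n))$, where $\mathbb K(G_n)=\mathbb K_R(G_n)$, under the composition $$F^{(n)}\xrightarrow{\ i\ } S^{(n)}\to H_1(S;RS_n)\xrightarrow{\ r_*\ } H_1(S;RG_n)\to H_1(S;\mathbb K(G_n)),$$ in which the second map sends $s\in S^{(n)}\subset S^{(n)}_r$ to its class in $H_1(S;RS_n)\cong \bigl(S^{(n)}_r/[S^{(n)}_r,S^{(n)}_r]\bigr)\otimes_{\mathbb Z}R$. -/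

import Mathlib

/-! ### Rational derived series -/

/-- The rational derived series `G_r^{(k)}` of a group: `G_r^{(0)} = G`, and `G_r^{(k+1)}` is the
kernel of `G_r^{(k)} → G_r^{(k)} / [G_r^{(k)}, G_r^{(k)}] → (G_r^{(k)} / [G_r^{(k)}, G_r^{(k)}]) ⊗ ℚ`,
i.e. the preimage in `G_r^{(k)}` of the torsion subgroup of its abelianization. -/
def rationalDerivedSeries (G : Type*) [Group G] : ℕ → Subgroup G
  | 0 => ⊤
  | k + 1 =>
    ((CommGroup.torsion (Abelianization (rationalDerivedSeries G k))).comap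
      Abelianization.of).map (rationalDerivedSeries G k).subtype

theorem mem_rationalDerivedSeries_succ {G : Type*} [Group G] {k : ℕ} {g : G} :
    g ∈ rationalDerivedSeries G (k + 1) ↔ g ∈ rationalDerivedSeries G k ∧
      ∃ m : ℕ, 0 < m ∧
        g ^ m ∈ ⁅rationalDerivedSeries G k, rationalDerivedSeries G k⁆ := by
  have key : ∀ x : rationalDerivedSeries G k,
      x ∈ (CommGroup.torsion (Abelianization (rationalDerivedSeries G k))).comap
        Abelianization.of ↔ ∃ m : ℕ, 0 < m ∧
          (x : G) ^ m ∈ ⁅rationalDerivedSeries G k, rationalDerivedSeries G k⁆ := by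
    intro x
    rw [Subgroup.mem_comap, CommGroup.mem_torsion, isOfFinOrder_iff_pow_eq_one]
    refine exists_congr fun m => and_congr_right fun _ => ?_
    rw [← map_pow, ← MonoidHom.mem_ker, Abelianization.ker_of, ← Subgroup.map_subtype_commutator,
      ← SubmonoidClass.coe_pow, ← Subgroup.coe_subtype,
      Subgroup.mem_map_iff_mem (Subgroup.subtype_injective _)]
  show g ∈ Subgroup.map _ _ ↔ _
  rw [Subgroup.mem_map]
  constructor
  · rintro ⟨x, hx, rfl⟩
    exact ⟨x.2, (key x).1 hx⟩
  · rintro ⟨hg, hm⟩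
    exact ⟨⟨g, hg⟩, (key ⟨g, hg⟩).2 hm, rfl⟩

theorem map_mem_rationalDerivedSeries {G H : Type*} [Group G] [Group H] (f : G →* H) (k : ℕ) :
    ∀ g ∈ rationalDerivedSeries G k, f g ∈ rationalDerivedSeries H k := by
  induction k with
  | zero => exact fun g _ => Subgroup.mem_top _
  | succ k ih =>
    intro g hg
    obtain ⟨hg, m, hm, hgm⟩ := mem_rationalDerivedSeries_succ.1 hg
    refine mem_rationalDerivedSeries_succ.2 ⟨ih g hg, m, hm, ?_⟩
    rw [← map_pow]
    have h1 := Subgroup.mem_map_of_mem f hgm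
    rw [Subgroup.map_commutator] at h1
    have h2 : (rationalDerivedSeries G k).map f ≤ rationalDerivedSeries H k := by
      rintro _ ⟨x, hx, rfl⟩
      exact ih x hx
    exact Subgroup.commutator_mono h2 h2 h1

instance rationalDerivedSeries_normal (G : Type*) [Group G] (k : ℕ) :
    (rationalDerivedSeries G k).Normal :=
  ⟨fun n hn g => map_mem_rationalDerivedSeries (MulAut.conj g).toMonoidHom k n hn⟩

theorem commutator_le_rationalDerivedSeries (G : Type*) [Group G] (k : ℕ) :
    ⁅rationalDerivedSeries G k, rationalDerivedSeries G k⁆ ≤ rationalDerivedSeries G (k + 1) :=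
  fun g hg => mem_rationalDerivedSeries_succ.2
    ⟨Subgroup.commutator_le_left _ _ hg, 1, one_pos, by rwa [pow_one]⟩

theorem derivedSeries_le_rationalDerivedSeries (G : Type*) [Group G] (k : ℕ) :
    derivedSeries G k ≤ rationalDerivedSeries G k := by
  induction k with
  | zero => exact le_top
  | succ k ih =>
    exact (Subgroup.commutator_mono ih ih).trans (commutator_le_rationalDerivedSeries G k)

/-! ### The group rings of the quotients `G / G_r^{(k)}` are Ore domains -/

/-- The Følner condition for a discrete group, in the one-sided form used to verify the Ore
condition. -/
def FolnerCondition (Γ : Type*) [Group Γ] : Prop :=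
  ∀ (T : Set Γ) (c : ℝ), T.Finite → 1 < c →
    ∃ F : Set Γ, F.Finite ∧ F.Nonempty ∧ (Set.ncard (Set.image2 (· * ·) F T) : ℝ) ≤ c * F.ncard

theorem FolnerCondition.of_comm {Γ : Type*} [Group Γ] (hc : ∀ a b : Γ, a * b = b * a) :
    FolnerCondition Γ := by
  classical
  let _ : CommGroup Γ := { (inferInstance : Group Γ) with mul_comm := hc }
  intro T' c hT hc
  obtain ⟨T, rfl⟩ := hT.exists_finset_coe
  by_cases hT0 : T = ∅
  · subst hT0
    refine ⟨{1}, Set.finite_singleton _, Set.singleton_nonempty _, ?_⟩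
    simp; linarith
  open Pointwise in
  have hpoly : ∀ n : ℕ, (T ^ n).card ≤ (n + 1) ^ T.card := by
    intro n
    have : T ^ n ⊆ (Fintype.piFinset fun _ : T => Finset.range (n + 1)).image
        (fun e => ∏ t : T, (t : Γ) ^ e t) := by
      intro a ha
      obtain ⟨f, rfl⟩ := Finset.mem_pow.1 ha
      refine Finset.mem_image.2 ⟨fun t => (Finset.univ.filter fun i => f i = t).card, ?_, ?_⟩
      · refine Fintype.mem_piFinset.2 fun t => Finset.mem_range_succ_iff.2 ?_
        exact (Finset.card_le_univ _).trans (by simp)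
      · rw [List.prod_ofFn, ← Finset.prod_fiberwise (s := Finset.univ) (g := f)]
        refine Finset.prod_congr rfl fun t _ => ?_
        rw [← Finset.prod_const]
        refine Finset.prod_congr rfl fun i hi => ?_
        rw [(Finset.mem_filter.1 hi).2]
    refine (Finset.card_le_card this).trans (Finset.card_image_le.trans ?_)
    simp [Fintype.card_piFinset]
  open Pointwise in
  have hex : ∃ n : ℕ, ((T ^ (n + 1)).card : ℝ) ≤ c * (T ^ n).card := by
    by_contra! hcon
    have hexp : ∀ n : ℕ, c ^ n ≤ ((T ^ n).card : ℝ) := by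
      intro n
      induction n with
      | zero => simp
      | succ n ih =>
        rw [pow_succ, mul_comm]
        exact (mul_le_mul_of_nonneg_left ih (by linarith)).trans (hcon n).le
    have hlim := (tendsto_pow_const_div_const_pow_of_one_lt T.card hc).comp
      (Filter.tendsto_add_atTop_nat 1)
    have hc0 : (0 : ℝ) < c := by linarith
    obtain ⟨n, hn⟩ := (hlim.eventually (gt_mem_nhds (inv_pos.2 hc0))).exists
    have h1 : c ^ n ≤ ((n : ℝ) + 1) ^ T.card := (hexp n).trans (by exact_mod_cast hpoly n)
    have hn' : ((n : ℝ) + 1) ^ T.card / c ^ (n + 1) < c⁻¹ := by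
      simpa [Function.comp] using hn
    rw [div_lt_iff₀ (by positivity), pow_succ, mul_comm (c ^ n), inv_mul_cancel_left₀ hc0.ne'] at hn'
    linarith
  obtain ⟨n, hn⟩ := hex
  refine ⟨((T ^ n : Finset Γ) : Set Γ), Finset.finite_toSet _, ?_, ?_⟩
  · exact Finset.coe_nonempty.2 ((Finset.nonempty_iff_ne_empty.2 hT0).pow)
  · have : Set.image2 (· * ·) ((T ^ n : Finset Γ) : Set Γ) (T : Set Γ) = ((T ^ (n + 1) : Finset Γ) : Set Γ) := by
      rw [pow_succ, Finset.coe_mul, Set.image2_mul]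
    rw [this, Set.ncard_coe_finset, Set.ncard_coe_finset]
    exact hn

theorem FolnerCondition.of_extension {Γ Q : Type*} [Group Γ] [Group Q] (f : Γ →* Q)
    (hf : Function.Surjective f) (hN : FolnerCondition f.ker) (hQ : FolnerCondition Q) :
    FolnerCondition Γ := by
  classical
  intro T c hT hc
  have hs : 1 < Real.sqrt c := by
    rw [← Real.sqrt_one]; exact Real.sqrt_lt_sqrt zero_le_one hc
  obtain ⟨E, hE, hE0, hEc⟩ := hQ (f '' T) _ (hT.image f) hs
  choose σ hσ using hf
  let ν : Q × Γ → f.ker := fun x => ⟨σ x.1 * x.2 * (σ (x.1 * f x.2))⁻¹, by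
    rw [MonoidHom.mem_ker]; simp [hσ]⟩
  obtain ⟨A, hA, hA0, hAc⟩ := hN (ν '' (E ×ˢ T)) _ ((hE.prod hT).image ν) hs
  let m : f.ker × Q → Γ := fun x => x.1 * σ x.2
  have hm : Function.Injective m := by
    rintro ⟨a, q⟩ ⟨a', q'⟩ h
    have h' : (a : Γ) * σ q = a' * σ q' := h
    have hq : q = q' := by
      have := congrArg f h'
      simpa [hσ, MonoidHom.mem_ker.1 a.2, MonoidHom.mem_ker.1 a'.2] using this
    subst hq
    have := mul_right_cancel h'
    simp [Subtype.ext_iff, this]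
  refine ⟨m '' (A ×ˢ E), (hA.prod hE).image m, (hA0.prod hE0).image m, ?_⟩
  have hsub : Set.image2 (· * ·) (m '' (A ×ˢ E)) T ⊆
      m '' (Set.image2 (· * ·) A (ν '' (E ×ˢ T)) ×ˢ Set.image2 (· * ·) E (f '' T)) := by
    rintro _ ⟨_, ⟨⟨a, e⟩, ⟨ha, he⟩, rfl⟩, t, ht, rfl⟩
    refine ⟨⟨a * ν (e, t), e * f t⟩,
      ⟨⟨a, ha, ν (e, t), ⟨(e, t), ⟨he, ht⟩, rfl⟩, rfl⟩, ⟨e, he, f t, ⟨t, ht, rfl⟩, rfl⟩⟩, ?_⟩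
    simp [m, ν, mul_assoc]
  have hfin := ((hA.image2 (· * ·) ((hE.prod hT).image ν)).prod
    (hE.image2 (· * ·) (hT.image f))).image m
  have h1 := Set.ncard_le_ncard hsub hfin
  rw [Set.ncard_image_of_injective _ hm, Set.ncard_prod] at h1
  rw [Set.ncard_image_of_injective _ hm, Set.ncard_prod]
  calc ((Set.image2 (· * ·) (m '' (A ×ˢ E)) T).ncard : ℝ)
      ≤ (Set.image2 (· * ·) A (ν '' (E ×ˢ T))).ncard * (Set.image2 (· * ·) E (f '' T)).ncard := by
        exact_mod_cast h1
    _ ≤ (Real.sqrt c * A.ncard) * (Real.sqrt c * E.ncard) := by gcongr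
    _ = (Real.sqrt c * Real.sqrt c) * (A.ncard * E.ncard) := by ring
    _ = c * ((A.ncard * E.ncard : ℕ) : ℝ) := by
        rw [Real.mul_self_sqrt (by linarith)]; push_cast; ring

theorem uniqueProds_of_comm {Γ : Type*} [Group Γ] (hc : ∀ a b : Γ, a * b = b * a)
    (ht : ∀ (a : Γ) (m : ℕ), 0 < m → a ^ m = 1 → a = 1) : UniqueProds Γ := by
  classical
  let _ : CommGroup Γ := { (inferInstance : Group Γ) with mul_comm := hc }
  refine ⟨fun {A B} hA hB => ?_⟩
  let H : Subgroup Γ := Subgroup.closure ((A ∪ B : Finset Γ) : Set Γ)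
  have hAH : ∀ a ∈ A, a ∈ H := fun a ha => Subgroup.subset_closure (by simp [ha])
  have hBH : ∀ a ∈ B, a ∈ H := fun a ha => Subgroup.subset_closure (by simp [ha])
  have : Monoid.FG H := by
    rw [← Group.fg_iff_monoid_fg, Group.fg_iff_subgroup_fg]
    exact ⟨A ∪ B, rfl⟩
  have : IsMulTorsionFree H := by
    refine ⟨fun n hn a b hab => ?_⟩
    have h0 : a ^ n = b ^ n := hab
    have : (a / b) ^ n = 1 := by rw [div_pow, h0, div_self']
    have h2 := ht ((a / b : H) : Γ) n (Nat.pos_of_ne_zero hn) (by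
      rw [← SubmonoidClass.coe_pow, this]; rfl)
    exact div_eq_one.1 (Subtype.ext h2)
  have hu : UniqueProds H := inferInstance
  obtain ⟨a0, ha0, b0, hb0, h⟩ := hu.uniqueMul_of_nonempty
    (A := A.subtype (· ∈ H)) (B := B.subtype (· ∈ H))
    (by obtain ⟨a, ha⟩ := hA; exact ⟨⟨a, hAH a ha⟩, by simpa using ha⟩)
    (by obtain ⟨a, ha⟩ := hB; exact ⟨⟨a, hBH a ha⟩, by simpa using ha⟩)
  refine ⟨a0, by simpa using ha0, b0, by simpa using hb0, fun a b ha hb hab => ?_⟩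
  have := @h ⟨a, hAH a ha⟩ ⟨b, hBH b hb⟩ (by simpa using ha) (by simpa using hb)
    (Subtype.ext hab)
  simpa [Subtype.ext_iff] using this

theorem uniqueProds_of_extension {Γ Q : Type*} [Group Γ] [Group Q] (f : Γ →* Q)
    (hN : UniqueProds f.ker) (hQ : UniqueProds Q) : UniqueProds Γ := by
  classical
  refine ⟨fun {A B} hA hB => ?_⟩
  obtain ⟨p, hp, q, hq, hpq⟩ := hQ.uniqueMul_of_nonempty (hA.image f) (hB.image f)
  obtain ⟨a0, ha0, rfl⟩ := Finset.mem_image.1 hp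
  obtain ⟨b0, hb0, rfl⟩ := Finset.mem_image.1 hq
  obtain ⟨u, hu, v, hv, huv⟩ := hN.uniqueMul_of_nonempty
    (A := (A.image (a0⁻¹ * ·)).subtype (· ∈ f.ker))
    (B := (B.image (· * b0⁻¹)).subtype (· ∈ f.ker))
    ⟨1, by simpa using ha0⟩ ⟨1, by simpa using hb0⟩
  have hu' : a0 * u ∈ A := by simpa using hu
  have hv' : v * b0 ∈ B := by simpa using hv
  refine ⟨a0 * u, hu', v * b0, hv', fun a b ha hb hab => ?_⟩
  have hfu : f u = 1 := u.2
  have hfv : f v = 1 := v.2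
  obtain ⟨h1, h2⟩ := hpq (Finset.mem_image_of_mem f ha) (Finset.mem_image_of_mem f hb) (by
    rw [← map_mul, hab]; simp [hfu, hfv])
  have h3 := @huv ⟨a0⁻¹ * a, by simp [MonoidHom.mem_ker, h1]⟩
    ⟨b * b0⁻¹, by simp [MonoidHom.mem_ker, h2]⟩ (by simpa using ha) (by simpa using hb) (by
      refine Subtype.ext ?_
      show a0⁻¹ * a * (b * b0⁻¹) = u * v
      calc a0⁻¹ * a * (b * b0⁻¹) = a0⁻¹ * (a * b) * b0⁻¹ := by group
        _ = u * v := by rw [hab]; group)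
  obtain ⟨h4, h5⟩ := h3
  rw [Subtype.ext_iff] at h4 h5
  exact ⟨by rw [← h4]; group, by rw [← h5]; group⟩

theorem exists_common_left_multiple {R Γ : Type*} [Field R] [Group Γ] [UniqueProds Γ]
    (hΓ : FolnerCondition Γ) (a b : MonoidAlgebra R Γ) (hb : b ≠ 0) :
    ∃ x y : MonoidAlgebra R Γ, y ≠ 0 ∧ y * a = x * b := by
  classical
  set T : Finset Γ := a.coeff.support ∪ b.coeff.support with hT
  obtain ⟨F', hF, hF0, hFc⟩ := hΓ T (3 / 2) T.finite_toSet (by norm_num)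
  obtain ⟨F, rfl⟩ := hF.exists_finset_coe
  set U : Finset Γ := Finset.image₂ (· * ·) F T with hU
  have hUc : (U.card : ℝ) ≤ 3 / 2 * F.card := by
    rw [← Finset.coe_image₂, Set.ncard_coe_finset, Set.ncard_coe_finset] at hFc
    exact hFc
  have hFpos : 0 < F.card := Finset.card_pos.2 (Finset.coe_nonempty.1 hF0)
  have hlt : U.card < F.card + F.card := by
    have : (0 : ℝ) < F.card := by exact_mod_cast hFpos
    have : (U.card : ℝ) < F.card + F.card := by linarith
    exact_mod_cast this
  let ι : (F → R) →ₗ[R] MonoidAlgebra R Γ :=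
    Fintype.linearCombination R fun t : F => MonoidAlgebra.single (t : Γ) (1 : R)
  have hι : ∀ c, ι c = 0 → c = 0 := by
    intro c hc
    funext t
    have h1 : (ι c).coeff (t : Γ) = 0 := by rw [hc]; rfl
    have h2 : (ι c).coeff (t : Γ) = c t := by
      simp [ι, Fintype.linearCombination_apply, MonoidAlgebra.coeff_sum, Finsupp.single_apply]
    rw [← h2, h1]; rfl
  have hιs : ∀ c, (ι c).coeff.support ⊆ F := by
    intro c g hg
    by_contra hgF
    refine (Finsupp.mem_support_iff.1 hg) ?_
    have : ∀ t : F, (t : Γ) ≠ g := fun t ht => hgF (ht ▸ t.2)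
    simp [ι, Fintype.linearCombination_apply, MonoidAlgebra.coeff_sum, this]
  let L : (F → R) × (F → R) →ₗ[R] (U → R) :=
    { toFun := fun c u => (ι c.1 * a - ι c.2 * b).coeff u
      map_add' := by
        intro c d; funext u; simp [add_mul]; ring
      map_smul' := by
        intro r c; funext u; simp [mul_sub] }
  have hker : LinearMap.ker L ≠ ⊥ := LinearMap.ker_ne_bot_of_finrank_lt (by simpa using hlt)
  obtain ⟨⟨c, d⟩, hcd, hne⟩ := (Submodule.ne_bot_iff _).1 hker
  have heq : ι c * a = ι d * b := by
    have hmem : ∀ (e : F → R) (z : MonoidAlgebra R Γ), z.coeff.support ⊆ T →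
        ∀ g, g ∉ U → (ι e * z).coeff g = 0 := by
      intro e z hz g hg
      rw [MonoidAlgebra.coeff_mul]
      refine Finset.sum_eq_zero fun s hs => Finset.sum_eq_zero fun t ht => if_neg fun h => hg ?_
      exact Finset.mem_image₂.2 ⟨s, hιs e hs, t, hz ht, h⟩
    ext g
    by_cases hg : g ∈ U
    · have h1 : (ι c * a - ι d * b).coeff g = 0 := congrFun (LinearMap.mem_ker.1 hcd) ⟨g, hg⟩
      rw [MonoidAlgebra.coeff_sub, Finsupp.sub_apply] at h1
      exact sub_eq_zero.1 h1
    · rw [hmem c a Finset.subset_union_left g hg, hmem d b Finset.subset_union_right g hg]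
  refine ⟨ι d, ι c, fun hc => hne ?_, heq⟩
  rw [hc, zero_mul] at heq
  have hd := (mul_eq_zero.1 heq.symm).resolve_right hb
  rw [hι c hc, hι d hd]; rfl

open scoped commutatorElement in
theorem quotient_rationalDerivedSeries_good (G : Type*) [Group G] (k : ℕ) :
    UniqueProds (G ⧸ rationalDerivedSeries G k) ∧
      FolnerCondition (G ⧸ rationalDerivedSeries G k) := by
  induction k with
  | zero =>
    have : Subsingleton (G ⧸ rationalDerivedSeries G 0) :=
      QuotientGroup.subsingleton_quotient_top
    exact ⟨uniqueProds_of_comm (fun _ _ => Subsingleton.elim _ _)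
      fun _ _ _ _ => Subsingleton.elim _ _,
      FolnerCondition.of_comm fun _ _ => Subsingleton.elim _ _⟩
  | succ k ih =>
    have hle : rationalDerivedSeries G (k + 1) ≤ rationalDerivedSeries G k :=
      fun g hg => (mem_rationalDerivedSeries_succ.1 hg).1
    let f : G ⧸ rationalDerivedSeries G (k + 1) →* G ⧸ rationalDerivedSeries G k :=
      QuotientGroup.map _ _ (MonoidHom.id G) hle
    have hf : Function.Surjective f := by
      rintro ⟨g⟩
      exact ⟨(g : G ⧸ rationalDerivedSeries G (k + 1)), rfl⟩
    have hker : ∀ g : G, ((g : G ⧸ rationalDerivedSeries G (k + 1)) ∈ f.ker) →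
        g ∈ rationalDerivedSeries G k := by
      intro g hg
      exact (QuotientGroup.eq_one_iff g).1 hg
    have hcomm : ∀ a b : f.ker, a * b = b * a := by
      rintro ⟨⟨a⟩, ha⟩ ⟨⟨b⟩, hb⟩
      refine Subtype.ext ?_
      show ((a * b : G) : G ⧸ rationalDerivedSeries G (k + 1)) = ((b * a : G) : _)
      rw [QuotientGroup.eq]
      have : (a * b)⁻¹ * (b * a) = ⁅b⁻¹, a⁻¹⁆ := by simp [commutatorElement_def, mul_assoc]
      rw [this]
      exact commutator_le_rationalDerivedSeries G k
        (Subgroup.commutator_mem_commutator (inv_mem (hker b hb)) (inv_mem (hker a ha)))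
    have htf : ∀ (a : f.ker) (m : ℕ), 0 < m → a ^ m = 1 → a = 1 := by
      rintro ⟨⟨a⟩, ha⟩ m hm h
      have h1 : ((a ^ m : G) : G ⧸ rationalDerivedSeries G (k + 1)) = 1 := congrArg Subtype.val h
      obtain ⟨_, m', hm', h2⟩ :=
        mem_rationalDerivedSeries_succ.1 ((QuotientGroup.eq_one_iff _).1 h1)
      rw [← pow_mul] at h2
      exact Subtype.ext ((QuotientGroup.eq_one_iff a).2
        (mem_rationalDerivedSeries_succ.2 ⟨hker a ha, m * m', Nat.mul_pos hm hm', h2⟩))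
    exact ⟨uniqueProds_of_extension f (uniqueProds_of_comm hcomm htf) ih.1,
      FolnerCondition.of_extension f hf (FolnerCondition.of_comm hcomm) ih.2⟩

section OreDomain

open nonZeroDivisors

variable (R : Type*) [Field R] (G : Type*) [Group G] (k : ℕ)

instance : UniqueProds (G ⧸ rationalDerivedSeries G k) :=
  (quotient_rationalDerivedSeries_good G k).1

noncomputable instance : OreLocalization.OreSet (MonoidAlgebra R (G ⧸ rationalDerivedSeries G k))⁰ :=
  Classical.choice <| OreLocalization.nonempty_oreSet_iff_of_noZeroDivisors.2 fun a b => by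
    obtain ⟨x, y, hy, h⟩ := exists_common_left_multiple
      (quotient_rationalDerivedSeries_good G k).2 a (b : MonoidAlgebra R _)
      (nonZeroDivisors.ne_zero b.2)
    exact ⟨x, ⟨y, mem_nonZeroDivisors_of_ne_zero hy⟩, h⟩

/-- The group ring `R G_k` of `G_k = G / G_r^{(k)}`. -/
abbrev QuotientGroupRing : Type _ := MonoidAlgebra R (G ⧸ rationalDerivedSeries G k)

/-- The skew quotient field `𝕂(G_k)` of the Ore domain `R G_k`, where `G_k = G / G_r^{(k)}`. -/
abbrev SkewQuotientField : Type _ :=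
  OreLocalization (QuotientGroupRing R G k)⁰ (QuotientGroupRing R G k)

/-- The canonical map `G → G_k → R G_k`. -/
noncomputable def toGroupRing : G →* QuotientGroupRing R G k :=
  (MonoidAlgebra.of R _).comp (QuotientGroup.mk' (rationalDerivedSeries G k))

/-- The canonical embedding `R G_k → 𝕂(G_k)`. -/
noncomputable def toSkewField : QuotientGroupRing R G k →+* SkewQuotientField R G k :=
  OreLocalization.numeratorRingHom

/-- The coefficient system `G → G_k → R G_k → 𝕂(G_k)`. -/
noncomputable def toUnitsSkewField : G →* SkewQuotientField R G k :=
  (toSkewField R G k : QuotientGroupRing R G k →* SkewQuotientField R G k).comp (toGroupRing R G k)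

end OreDomain

/-! ### First homology of a group with twisted coefficients

For a group `S`, a ring `A` and a homomorphism `φ : S → Aˣ`, the complex `A ⊗_{ℤS} B_*`, with `B_*`
the bar resolution and `S` acting on the right of `A` through `φ`, is a complex of free left
`A`-modules. In low degrees it is
`A^(S × S) → A^(S) → A`, `∂[s|t] = φ(s)[t] - [st] + [s]`, `∂[s] = φ(s) - 1`. -/

section TwistedHomology

variable {A B : Type*} [Ring A] [Ring B] {S T : Type*} [Group S] [Group T]

/-- The boundary map from 1-chains to 0-chains. -/
noncomputable def twistedD₁ (φ : S →* A) : (S →₀ A) →ₗ[A] A :=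
  Finsupp.linearCombination A fun s => φ s - 1

/-- The boundary map from 2-chains to 1-chains. -/
noncomputable def twistedD₂ (φ : S →* A) : (S × S →₀ A) →ₗ[A] (S →₀ A) :=
  Finsupp.linearCombination A fun x =>
    Finsupp.single x.2 (φ x.1) - Finsupp.single (x.1 * x.2) 1 + Finsupp.single x.1 1

theorem twistedD₁_comp_twistedD₂ (φ : S →* A) : twistedD₁ φ ∘ₗ twistedD₂ φ = 0 := by
  ext x
  simp [twistedD₁, twistedD₂, mul_sub]

/-- `H₁(S; A)`, with `A` twisted by `φ : S → Aˣ`: the left `A`-module of 1-cycles modulo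
1-boundaries, i.e. the kernel of the map from 1-chains modulo 1-boundaries to 0-chains induced by
the boundary map. -/
abbrev TwistedH1 (φ : S →* A) : Type _ :=
  LinearMap.ker ((LinearMap.range (twistedD₂ φ)).liftQ (twistedD₁ φ)
    (LinearMap.range_le_ker_iff.2 (twistedD₁_comp_twistedD₂ φ)))

/-- The homology class of a 1-cycle. -/
noncomputable def TwistedH1.mk (φ : S →* A) (z : S →₀ A) (hz : twistedD₁ φ z = 0) : TwistedH1 φ :=
  ⟨Submodule.Quotient.mk z, hz⟩

/-- Every homology class is the class of a 1-cycle. -/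
theorem TwistedH1.exists_mk_eq {φ : S →* A} (c : TwistedH1 φ) :
    ∃ (z : S →₀ A) (hz : twistedD₁ φ z = 0), TwistedH1.mk φ z hz = c := by
  obtain ⟨⟨z⟩, hz⟩ := c
  exact ⟨z, hz, rfl⟩

/-- Two 1-cycles are homologous if and only if they differ by a 1-boundary. -/
theorem TwistedH1.mk_eq_mk_iff {φ : S →* A} {z z' : S →₀ A} (hz : twistedD₁ φ z = 0)
    (hz' : twistedD₁ φ z' = 0) :
    TwistedH1.mk φ z hz = TwistedH1.mk φ z' hz' ↔ ∃ c, twistedD₂ φ c = z - z' :=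
  Subtype.ext_iff.trans (Submodule.Quotient.eq _)

/-- The map on 1-chains induced by a homomorphism of groups and a homomorphism of coefficient
rings. -/
noncomputable def twistedChainMap (f : S →* T) (ψ : A →+* B) : (S →₀ A) →ₛₗ[ψ] (T →₀ B) :=
  (Finsupp.lmapDomain B B f).comp (Finsupp.mapRange.linearMap ψ.toSemilinearMap)

@[simp]
theorem twistedChainMap_single (f : S →* T) (ψ : A →+* B) (s : S) (a : A) :
    twistedChainMap f ψ (Finsupp.single s a) = Finsupp.single (f s) (ψ a) := by
  simp [twistedChainMap]

theorem twistedD₁_twistedChainMap {φ : S →* A} {φ' : T →* B} (f : S →* T) (ψ : A →+* B)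
    (h : ∀ s, ψ (φ s) = φ' (f s)) (x : S →₀ A) :
    twistedD₁ φ' (twistedChainMap f ψ x) = ψ (twistedD₁ φ x) := by
  induction x using Finsupp.induction_linear with
  | zero => simp
  | add x y hx hy => simp [hx, hy]
  | single s a => simp [twistedD₁, h]

theorem twistedChainMap_mem_range {φ : S →* A} {φ' : T →* B} (f : S →* T) (ψ : A →+* B)
    (h : ∀ s, ψ (φ s) = φ' (f s)) (x : S × S →₀ A) :
    twistedChainMap f ψ (twistedD₂ φ x) ∈ LinearMap.range (twistedD₂ φ') := by
  induction x using Finsupp.induction_linear with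
  | zero => simp
  | add x y hx hy => rw [map_add, map_add]; exact add_mem hx hy
  | single s a =>
    refine ⟨Finsupp.single (f s.1, f s.2) (ψ a), ?_⟩
    simp only [twistedD₂, Finsupp.linearCombination_single, smul_sub, smul_add, Finsupp.smul_single,
      map_sub, map_add, twistedChainMap_single, smul_eq_mul, map_mul, mul_one, h]

/-- The map `H₁(S; A) → H₁(T; B)` induced by a homomorphism `f : S → T` and a compatible
homomorphism `ψ : A → B` of coefficient rings. -/
noncomputable def TwistedH1.map {φ : S →* A} {φ' : T →* B} (f : S →* T) (ψ : A →+* B)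
    (h : ∀ s, ψ (φ s) = φ' (f s)) : TwistedH1 φ →ₛₗ[ψ] TwistedH1 φ' :=
  (Submodule.mapQ (LinearMap.range (twistedD₂ φ)) (LinearMap.range (twistedD₂ φ'))
    (twistedChainMap f ψ) (by
      rintro _ ⟨y, rfl⟩
      exact twistedChainMap_mem_range f ψ h y)).restrict (by
    rintro ⟨x⟩ hx
    have hx' : twistedD₁ φ x = 0 := hx
    show twistedD₁ φ' (twistedChainMap f ψ x) = 0
    rw [twistedD₁_twistedChainMap f ψ h, hx', map_zero])

theorem TwistedH1.map_mk {φ : S →* A} {φ' : T →* B} (f : S →* T) (ψ : A →+* B)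
    (h : ∀ s, ψ (φ s) = φ' (f s)) (z : S →₀ A) (hz : twistedD₁ φ z = 0) :
    TwistedH1.map f ψ h (TwistedH1.mk φ z hz) = TwistedH1.mk φ' (twistedChainMap f ψ z)
      (by rw [twistedD₁_twistedChainMap f ψ h, hz, map_zero]) :=
  rfl

/-- The map `H₁(S; A) → H₁(T; A)` induced by `f : S → T`, where `S` acts on `A` through `f`. -/
noncomputable def TwistedH1.mapGroup (f : S →* T) (φ : T →* A) :
    TwistedH1 (φ.comp f) →ₗ[A] TwistedH1 φ :=
  TwistedH1.map f (RingHom.id A) fun _ => rfl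

/-- The map `H₁(S; A) → H₁(S; B)` induced by a homomorphism `ψ : A → B` of coefficient rings. -/
noncomputable def TwistedH1.mapCoeff {φ : S →* A} {φ' : S →* B} (ψ : A →+* B)
    (h : ∀ s, ψ (φ s) = φ' s) : TwistedH1 φ →ₛₗ[ψ] TwistedH1 φ' :=
  TwistedH1.map (MonoidHom.id S) ψ h

/-- The class `[s] ∈ H₁(S; A)` of an element `s` which acts trivially on `A`. -/
noncomputable def TwistedH1.of (φ : S →* A) (s : S) (hs : φ s = 1) : TwistedH1 φ :=
  TwistedH1.mk φ (Finsupp.single s 1) (by simp [twistedD₁, hs])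

end TwistedHomology

/-! ### Algebraic solutions -/

section AlgebraicSolution

variable (R : Type*) [Field R] {F S G : Type*} [Group F] [Group S] [Group G]

/-- For a group `S` with `H₁(S; R) ≠ 0`, a free group `F` and `i : F → S` (where `R = ℚ` or
`R = ℤ/p`): `r : S → G` is an `R`-algebraic `n`-solution for
`i : F → S`. -/
structure IsAlgebraicSolution (n : ℕ) (i : F →* S) (r : S →* G) : Prop where
  /-- `H₁(S; R) ≠ 0`. -/
  nontrivial_H1 : Nontrivial (TwistedH1 (1 : S →* R))
  /-- `r` is a nontrivial homomorphism. -/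
  ne_one : r ≠ 1
  /-- `r_* : H₁(S; 𝕂(G_k)) → H₁(G; 𝕂(G_k))` is nontrivial for `0 ≤ k ≤ n - 1`. -/
  map_ne_zero : ∀ k < n, TwistedH1.mapGroup r (toUnitsSkewField R G k) ≠ 0
  /-- `i_* : H₁(F; 𝕂(G_k)) → H₁(S; 𝕂(G_k))` is surjective for `0 ≤ k ≤ n`. -/
  map_surjective : ∀ k ≤ n,
    Function.Surjective (TwistedH1.mapGroup i ((toUnitsSkewField R G k).comp r))

theorem toGroupRing_eq_one (n : ℕ) (s : S) (hs : s ∈ rationalDerivedSeries S n) :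
    toGroupRing R S n s = 1 := by
  simp only [toGroupRing, MonoidHom.comp_apply, QuotientGroup.mk'_apply]
  rw [(QuotientGroup.eq_one_iff s).2 hs, map_one]

/-- The map `R S_n → R G_n` induced by `r : S → G`. -/
noncomputable def groupRingMap (n : ℕ) (r : S →* G) :
    QuotientGroupRing R S n →+* QuotientGroupRing R G n :=
  MonoidAlgebra.mapDomainRingHom R
    (QuotientGroup.map (rationalDerivedSeries S n) (rationalDerivedSeries G n) r
      (map_mem_rationalDerivedSeries r n))

/-- The map `S^{(n)} → H₁(S; R S_n)`, sending `s` to the class of the cycle `[s]`. -/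
noncomputable def derivedToH1 (n : ℕ) (s : derivedSeries S n) : TwistedH1 (toGroupRing R S n) :=
  TwistedH1.of _ (s : S) (toGroupRing_eq_one R n (s : S) (derivedSeries_le_rationalDerivedSeries S n s.2))

/-- The map `r_* : H₁(S; R S_n) → H₁(S; R G_n)`. -/
noncomputable def changeToGn (n : ℕ) (r : S →* G) :
    TwistedH1 (toGroupRing R S n) →ₛₗ[groupRingMap R n r] TwistedH1 ((toGroupRing R G n).comp r) :=
  TwistedH1.mapCoeff _ fun s => by
    simp [groupRingMap, toGroupRing, MonoidAlgebra.of_apply]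
    rfl

/-- The map `H₁(S; R G_n) → H₁(S; 𝕂(G_n))`. -/
noncomputable def changeToField (n : ℕ) (r : S →* G) :
    TwistedH1 ((toGroupRing R G n).comp r) →ₛₗ[toSkewField R G n]
      TwistedH1 ((toUnitsSkewField R G n).comp r) :=
  TwistedH1.mapCoeff _ fun _ => rfl

/-- The map `F^{(n)} → S^{(n)}` induced by `i : F → S`. -/
def derivedMap (n : ℕ) (i : F →* S) (w : derivedSeries F n) : derivedSeries S n :=
  ⟨i w, map_derivedSeries_le_derivedSeries i n (Subgroup.mem_map_of_mem i w.2)⟩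

/-- The composition `F^{(n)} → S^{(n)} → H₁(S; R S_n) → H₁(S; R G_n) → H₁(S; 𝕂(G_n))`. -/
noncomputable def derivedToFieldH1 (n : ℕ) (i : F →* S) (r : S →* G) (w : derivedSeries F n) :
    TwistedH1 ((toUnitsSkewField R G n).comp r) :=
  changeToField R n r (changeToGn R n r (derivedToH1 R n (derivedMap n i w)))

end AlgebraicSolution

/-!
The collections are built by recursion. For `n = 0` there is one set, the basis `x_1, …, x_{2g}`.
For the step from `n` to `n + 1`, one takes an element `w` of a set in the collection for `n` and an
index `j₀`, and forms the set of the `2g - 1` commutators `[w, x_j w x_j⁻¹]` with `j ≠ j₀`.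

*Why these span.* Let `w ∈ F^{(n)}` act nontrivially on `𝕂 = 𝕂(G_{n+1})`. Since `w` and `x_j w x_j⁻¹`
commute in `G_{n+1}`, every crossed homomorphism `D` satisfies
`D [w, x_j w x_j⁻¹] = c_j D x_j + d_j D w` with `c_j ≠ 0` (`exists_map_commutator_conj_eq`). Apply
this to the tautological crossed homomorphism sending `s` to the chain `[s]` modulo boundaries. Modulo
the commutators and `[w]`, all `[x_j]` with `j ≠ j₀` vanish; by Fox's formula
`[w] = ∑ (∂w/∂x_j) [x_j]`, so does `[x_{j₀}]` if `∂w/∂x_{j₀} ≠ 0`. So the commutators and `[w]` span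
all chains modulo boundaries, and as the boundary `w - 1` of `[w]` is nonzero, the commutators alone
span the cycles, i.e. `H₁(F; 𝕂)` (`TwistedH1.span_of_commutator_conj`), which maps onto `H₁(S; 𝕂)`.

*Finding `w`.* By induction some set of the collection for `n` spans `H₁(S; 𝕂_ℚ(G_n))`; as `r_*` is
nonzero there, the class in `H₁(G; 𝕂_ℚ(G_n))` of one of its elements `w` is nonzero. In
characteristic zero this forces `w` to survive in `G_{n+1}`
(`exists_notMem_rationalDerivedSeries_succ`), a condition in which the coefficients no longer occur.

*Finding `j₀`.* As `w - 1 = ∑ (∂w/∂x_j) (x_j - 1)` is nonzero, some Fox derivative of `w` is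
nonzero over `ℤ/p`. It is the reduction of the Fox derivative over `ℤ G_{n+1}`, which therefore is
nonzero too, and so is its image over `ℚ`. The same `w` and `j₀` thus serve both coefficient fields.
-/

/-! ### Crossed homomorphisms and Fox derivatives -/

section FoxCalculus

variable {F A M ι : Type*} [Group F] [Ring A] [AddCommGroup M] [Module A M]

/-- A crossed homomorphism `D : F → M` into an `A`-module on which `F` acts through `φ : F → A`. -/
def IsCrossedHom (φ : F →* A) (D : F → M) : Prop :=
  ∀ s t, D (s * t) = D s + φ s • D t

namespace IsCrossedHom

variable {φ : F →* A} {D E : F → M}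

theorem map_one (hD : IsCrossedHom φ D) : D 1 = 0 := by
  have h := hD 1 1
  rw [mul_one, _root_.map_one, one_smul] at h
  exact left_eq_add.1 h

theorem map_inv (hD : IsCrossedHom φ D) (s : F) : D s⁻¹ = -(φ s⁻¹ • D s) := by
  have h := hD s⁻¹ s
  rw [inv_mul_cancel, hD.map_one] at h
  exact eq_neg_of_add_eq_zero_left h.symm

theorem map_conj (hD : IsCrossedHom φ D) (x w : F) :
    D (x * w * x⁻¹) = (1 - φ (x * w * x⁻¹)) • D x + φ x • D w := by
  rw [hD (x * w), hD x, hD.map_inv, smul_neg, smul_smul, ← map_mul, sub_smul, one_smul]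
  abel

open scoped commutatorElement in
/-- The value on a commutator of two elements whose actions commute. -/
theorem map_commutator (hD : IsCrossedHom φ D) (w v : F) (h : Commute (φ w) (φ v)) :
    D ⁅w, v⁆ = (1 - φ v) • D w + (φ w - 1) • D v := by
  have h1 : φ (w * v * w⁻¹) = φ v := by
    rw [map_mul, map_mul, h.eq, mul_assoc, ← map_mul, mul_inv_cancel, _root_.map_one, mul_one]
  have h2 : φ (w * v * w⁻¹ * v⁻¹) = 1 := by
    rw [map_mul, h1, ← map_mul, mul_inv_cancel, _root_.map_one]
  rw [commutatorElement_def, hD (w * v * w⁻¹), hD.map_inv v, smul_neg, smul_smul, ← map_mul, h2,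
    hD.map_conj, h1, sub_smul (φ w), one_smul]
  abel

/-- A crossed homomorphism on a free group is determined by its values on a basis. -/
theorem ext_basis (hD : IsCrossedHom φ D) (hE : IsCrossedHom φ E) (b : FreeGroupBasis ι F)
    (h : ∀ j, D (b j) = E (b j)) : D = E := by
  let H : Subgroup F :=
    { carrier := {s | D s = E s}
      one_mem' := by simp [hD.map_one, hE.map_one]
      mul_mem' := by
        intro s t hs ht
        simp only [Set.mem_ofPred_eq] at *
        rw [hD, hE, hs, ht]
      inv_mem' := by
        intro s hs
        simp only [Set.mem_ofPred_eq] at *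
        rw [hD.map_inv, hE.map_inv, hs] }
  have hid : H.subtype.comp (b.lift fun j => (⟨b j, h j⟩ : H)) = MonoidHom.id F := by
    refine b.ext_hom _ _ fun j => ?_
    have : b.lift (fun j => (⟨b j, h j⟩ : H)) (b j) = ⟨b j, h j⟩ := by simp
    simp [this]
  funext s
  have hs := DFunLike.congr_fun hid s
  have hm := (b.lift (fun j => (⟨b j, h j⟩ : H)) s).2
  simp only [MonoidHom.comp_apply, Subgroup.coe_subtype, MonoidHom.id_apply] at hs
  rw [hs] at hm
  exact hm

end IsCrossedHom

/-- The action of `F` on the additive group `ι → A` by left multiplication through `φ`, as a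
homomorphism to the automorphisms of the multiplicative copy of that group. -/
def coordinateAction (ι : Type*) (φ : F →* A) : F →* MulAut (Multiplicative (ι → A)) where
  toFun s :=
    { toFun := fun v => Multiplicative.ofAdd (φ s • v.toAdd)
      invFun := fun v => Multiplicative.ofAdd (φ s⁻¹ • v.toAdd)
      left_inv := fun v => by
        simp [smul_smul, ← map_mul]
      right_inv := fun v => by
        simp [smul_smul, ← map_mul]
      map_mul' := fun v w => by simp [smul_add] }
  map_one' := by ext v; simp
  map_mul' s t := by ext v; simp [mul_assoc]

theorem coordinateAction_apply (φ : F →* A) (s : F) (v : Multiplicative (ι → A)) :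
    (coordinateAction ι φ s v).toAdd = φ s • v.toAdd :=
  rfl

variable [DecidableEq ι]

/-- The vector of Fox derivatives `∂s/∂x_j`, pushed forward to `A` along `φ`, of an element `s` of
a free group with basis `b = (x_j)`. It is read off from the homomorphism from `F` to the semidirect
product `(ι → A) ⋊ F` which lifts the identity and sends `x_j` to `(e_j, x_j)`. -/
def foxDerivative (b : FreeGroupBasis ι F) (φ : F →* A) (s : F) : ι → A :=
  (b.lift (fun j => (⟨Multiplicative.ofAdd (Pi.single j 1), b j⟩ :
    Multiplicative (ι → A) ⋊[coordinateAction ι φ] F)) s).left.toAdd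

theorem foxDerivative_basis (b : FreeGroupBasis ι F) (φ : F →* A) (j : ι) :
    foxDerivative b φ (b j) = Pi.single j 1 := by
  simp [foxDerivative]

theorem isCrossedHom_foxDerivative (b : FreeGroupBasis ι F) (φ : F →* A) :
    IsCrossedHom φ (foxDerivative b φ) := by
  intro s t
  let L := b.lift (fun j => (⟨Multiplicative.ofAdd (Pi.single j 1), b j⟩ :
    Multiplicative (ι → A) ⋊[coordinateAction ι φ] F))
  have hL : SemidirectProduct.rightHom.comp L = MonoidHom.id F :=
    b.ext_hom _ _ fun j => by simp [L]
  have hs : (L s).right = s := DFunLike.congr_fun hL s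
  show (L (s * t)).left.toAdd = (L s).left.toAdd + φ s • (L t).left.toAdd
  rw [map_mul, SemidirectProduct.mul_left, toAdd_mul, hs, coordinateAction_apply]

/-- Fox derivatives are natural in the coefficient ring. -/
theorem foxDerivative_map {B : Type*} [Ring B] (b : FreeGroupBasis ι F) (φ : F →* A) (ψ : A →+* B)
    (φ' : F →* B) (h : ∀ s, ψ (φ s) = φ' s) (s : F) (j : ι) :
    ψ (foxDerivative b φ s j) = foxDerivative b φ' s j := by
  have hc : IsCrossedHom φ' fun s j => ψ (foxDerivative b φ s j) := by
    intro s t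
    funext j
    simp [isCrossedHom_foxDerivative b φ s t, h]
  refine congrFun (congrFun (hc.ext_basis (isCrossedHom_foxDerivative b φ') b fun j => ?_) s) j
  funext k
  by_cases hk : k = j <;> simp [foxDerivative_basis, hk]

end FoxCalculus

section FoxCalculus

variable {F A M ι : Type*} [Group F] [Ring A] [AddCommGroup M] [Module A M] [DecidableEq ι]
  [Fintype ι]

/-- Fox's fundamental formula, for an arbitrary crossed homomorphism. -/
theorem IsCrossedHom.eq_sum_foxDerivative {φ : F →* A} {D : F → M} (hD : IsCrossedHom φ D)
    (b : FreeGroupBasis ι F) (s : F) :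
    D s = ∑ j, foxDerivative b φ s j • D (b j) := by
  refine congrFun (hD.ext_basis (E := fun s => ∑ j, foxDerivative b φ s j • D (b j)) ?_ b ?_) s
  · intro s t
    simp [isCrossedHom_foxDerivative b φ s t, add_smul, Finset.sum_add_distrib, Finset.smul_sum,
      mul_smul]
  · intro j
    simp [foxDerivative_basis, Pi.single_apply]

theorem isCrossedHom_sub_one (φ : F →* A) : IsCrossedHom φ fun s => φ s - 1 := by
  intro s t
  simp [mul_sub]

theorem exists_foxDerivative_ne_zero (b : FreeGroupBasis ι F) (φ : F →* A) {w : F}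
    (hw : φ w ≠ 1) : ∃ j, foxDerivative b φ w j ≠ 0 := by
  by_contra! h
  refine hw (sub_eq_zero.1 ?_)
  rw [(isCrossedHom_sub_one φ).eq_sum_foxDerivative b w]
  simp [h]

end FoxCalculus

/-! ### Commutators spanning the first homology of a free group -/

section Spanning

open scoped commutatorElement

variable {F K M ι : Type*} [Group F] [DivisionRing K] [AddCommGroup M] [Module K M]
  {φ : F →* K} {w : F}

theorem map_conj_ne_one {A : Type*} [Monoid A] {φ : F →* A} (hw : φ w ≠ 1) (x : F) :
    φ (x * w * x⁻¹) ≠ 1 := by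
  intro h
  apply hw
  have : w = x⁻¹ * (x * w * x⁻¹) * x := by group
  rw [this, map_mul, map_mul, h, mul_one, ← map_mul, inv_mul_cancel, map_one]

/-- The value of a crossed homomorphism on `[w, x w x⁻¹]` is a nonzero multiple of its value at `x`,
up to a multiple of its value at `w`. The two coefficients do not depend on the crossed
homomorphism. -/
theorem exists_map_commutator_conj_eq (hw : φ w ≠ 1) (x : F)
    (hx : Commute (φ w) (φ (x * w * x⁻¹))) :
    ∃ c d : K, c ≠ 0 ∧ ∀ {M : Type*} [AddCommGroup M] [Module K M] {D : F → M},
      IsCrossedHom φ D → D ⁅w, x * w * x⁻¹⁆ = c • D x + d • D w := by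
  refine ⟨(φ w - 1) * (1 - φ (x * w * x⁻¹)), 1 - φ (x * w * x⁻¹) + (φ w - 1) * φ x,
    mul_ne_zero (sub_ne_zero.2 hw) (sub_ne_zero.2 (map_conj_ne_one hw x).symm), fun hD => ?_⟩
  rw [hD.map_commutator w _ hx, hD.map_conj, smul_add, smul_smul, smul_smul, add_smul]
  abel

variable [DecidableEq ι] (b : FreeGroupBasis ι F)

theorem injOn_commutator_conj (hw : φ w ≠ 1)
    (hc : ∀ j, Commute (φ w) (φ (b j * w * (b j)⁻¹))) {j₀ : ι}
    (hj₀ : foxDerivative b φ w j₀ ≠ 0) :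
    Set.InjOn (fun j => ⁅w, b j * w * (b j)⁻¹⁆) {j | j ≠ j₀} := by
  intro j hj k hk hjk
  by_contra hne
  obtain ⟨c, d, hc0, hcd⟩ := exists_map_commutator_conj_eq hw (b j) (hc j)
  obtain ⟨c', d', -, hcd'⟩ := exists_map_commutator_conj_eq hw (b k) (hc k)
  have h := congrArg (foxDerivative b φ) hjk
  simp only at h
  rw [hcd (isCrossedHom_foxDerivative b φ), hcd' (isCrossedHom_foxDerivative b φ),
    foxDerivative_basis, foxDerivative_basis] at h
  have h0 := congrFun h j₀
  have h1 := congrFun h j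
  simp only [Set.mem_ofPred_eq] at hj hk
  simp [Ne.symm hj, Ne.symm hk, hj₀] at h0
  simp [hne, h0, hc0] at h1

/-- The commutators and `w` span everything the values of `D` span: modulo them, `D x_j` vanishes for
`j ≠ j₀` because `c_j ≠ 0`, and Fox's formula for `D w` then kills `D x_{j₀}`. -/
theorem span_commutator_conj_sup_span_eq_top [Fintype ι] {D : F → M} (hD : IsCrossedHom φ D)
    (hspan : Submodule.span K (Set.range D) = ⊤) (hw : φ w ≠ 1)
    (hc : ∀ j, Commute (φ w) (φ (b j * w * (b j)⁻¹))) {j₀ : ι}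
    (hj₀ : foxDerivative b φ w j₀ ≠ 0) :
    Submodule.span K ((fun j => D ⁅w, b j * w * (b j)⁻¹⁆) '' {j | j ≠ j₀}) ⊔ K ∙ D w = ⊤ := by
  set N := Submodule.span K ((fun j => D ⁅w, b j * w * (b j)⁻¹⁆) '' {j | j ≠ j₀}) ⊔ K ∙ D w
    with hN
  have hwN : D w ∈ N := Submodule.mem_sup_right (Submodule.mem_span_singleton_self _)
  have hj : ∀ j, j ≠ j₀ → D (b j) ∈ N := by
    intro j hj
    obtain ⟨c, d, hc0, hcd⟩ := exists_map_commutator_conj_eq hw (b j) (hc j)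
    have h1 : D ⁅w, b j * w * (b j)⁻¹⁆ ∈ N :=
      Submodule.mem_sup_left (Submodule.subset_span ⟨j, hj, rfl⟩)
    rw [hcd hD] at h1
    exact (Submodule.smul_mem_iff _ hc0).1
      ((Submodule.add_mem_iff_left _ (Submodule.smul_mem _ _ hwN)).1 h1)
  have hb : ∀ j, D (b j) ∈ N := by
    intro j
    by_cases hjj : j = j₀
    · subst hjj
      have h1 := hwN
      rw [hD.eq_sum_foxDerivative b w, ← Finset.add_sum_erase _ _ (Finset.mem_univ j)] at h1
      refine (Submodule.smul_mem_iff _ hj₀).1 ((Submodule.add_mem_iff_left _ ?_).1 h1)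
      exact Submodule.sum_mem _ fun k hk => Submodule.smul_mem _ _ (hj k (Finset.ne_of_mem_erase hk))
    · exact hj j hjj
  rw [← top_le_iff, ← hspan, Submodule.span_le]
  rintro _ ⟨s, rfl⟩
  rw [hD.eq_sum_foxDerivative b s]
  exact Submodule.sum_mem _ fun k _ => Submodule.smul_mem _ _ (hb k)

end Spanning

section TwistedHomology

open scoped commutatorElement

variable {A : Type*} [Ring A] {S : Type*} [Group S]

/-- The class of the chain `[s]`, not necessarily a cycle, modulo 1-boundaries. -/
noncomputable def chainClass (φ : S →* A) (s : S) :
    (S →₀ A) ⧸ LinearMap.range (twistedD₂ φ) :=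
  Submodule.Quotient.mk (Finsupp.single s 1)

theorem isCrossedHom_chainClass (φ : S →* A) : IsCrossedHom φ (chainClass φ) := by
  intro s t
  simp only [chainClass, ← Submodule.Quotient.mk_smul, ← Submodule.Quotient.mk_add]
  rw [eq_comm, Submodule.Quotient.eq]
  refine ⟨Finsupp.single (s, t) 1, ?_⟩
  simp [twistedD₂]
  abel

theorem span_range_chainClass (φ : S →* A) :
    Submodule.span A (Set.range (chainClass φ)) = ⊤ := by
  rw [← top_le_iff]
  rintro ⟨z⟩ -
  change Submodule.Quotient.mk z ∈ _
  induction z using Finsupp.induction_linear with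
  | zero => exact zero_mem _
  | add x y hx hy => rw [Submodule.Quotient.mk_add]; exact add_mem hx hy
  | single s a =>
    have : Finsupp.single s a = a • Finsupp.single s (1 : A) := by simp
    rw [this, Submodule.Quotient.mk_smul]
    exact Submodule.smul_mem _ _ (Submodule.subset_span ⟨s, rfl⟩)

theorem TwistedH1.coe_of (φ : S →* A) (s : S) (hs : φ s = 1) :
    (TwistedH1.of φ s hs : (S →₀ A) ⧸ LinearMap.range (twistedD₂ φ)) = chainClass φ s :=
  rfl

theorem TwistedH1.map_of {B T : Type*} [Ring B] [Group T] {φ : S →* A} {φ' : T →* B} (f : S →* T)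
    (ψ : A →+* B) (h : ∀ s, ψ (φ s) = φ' (f s)) (s : S) (hs : φ s = 1) :
    TwistedH1.map f ψ h (TwistedH1.of φ s hs) =
      TwistedH1.of φ' (f s) (by rw [← h, hs, map_one]) := by
  refine Subtype.ext ?_
  change Submodule.Quotient.mk (twistedChainMap f ψ (Finsupp.single s 1)) =
    Submodule.Quotient.mk (Finsupp.single (f s) 1)
  rw [twistedChainMap_single, map_one]

theorem TwistedH1.mapCoeff_of {B : Type*} [Ring B] {φ : S →* A} {φ' : S →* B} (ψ : A →+* B)
    (h : ∀ s, ψ (φ s) = φ' s) (s : S) (hs : φ s = 1) :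
    TwistedH1.mapCoeff ψ h (TwistedH1.of φ s hs) =
      TwistedH1.of φ' s (by rw [← h, hs, map_one]) :=
  TwistedH1.map_of (MonoidHom.id S) ψ h s hs

theorem TwistedH1.mapGroup_of {T : Type*} [Group T] (f : S →* T) (φ : T →* A) (s : S)
    (hs : φ.comp f s = 1) :
    TwistedH1.mapGroup f φ (TwistedH1.of (φ.comp f) s hs) = TwistedH1.of φ (f s) hs :=
  TwistedH1.map_of f (RingHom.id A) _ s hs

theorem Submodule.span_eq_top_of_coe_mem_span {M : Type*} [AddCommGroup M] [Module A M]
    {N : Submodule A M} {X : Set N} (h : ∀ z : N, (z : M) ∈ span A (Subtype.val '' X)) :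
    span A X = ⊤ := by
  rw [← top_le_iff]
  intro z _
  have hz : (z : M) ∈ (span A X).map N.subtype := by
    rw [Submodule.map_span]
    exact h z
  obtain ⟨y, hy, hyz⟩ := hz
  rwa [← Subtype.ext hyz]

/-- If the free group `S` acts trivially, the classes of a basis span `H₁(S; A)`. -/
theorem TwistedH1.span_of_basis {ι : Type*} [Fintype ι] [DecidableEq ι]
    (b : FreeGroupBasis ι S) (φ : S →* A) (hφ : ∀ s, φ s = 1) :
    Submodule.span A (Set.range fun j => TwistedH1.of φ (b j) (hφ _)) = ⊤ := by
  refine Submodule.span_eq_top_of_coe_mem_span fun z => ?_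
  rw [← Set.range_comp]
  have hz : (z : (S →₀ A) ⧸ LinearMap.range (twistedD₂ φ)) ∈
      Submodule.span A (Set.range (chainClass φ)) := by
    rw [span_range_chainClass]; trivial
  refine (Submodule.span_le.2 ?_) hz
  rintro _ ⟨s, rfl⟩
  rw [(isCrossedHom_chainClass φ).eq_sum_foxDerivative b s]
  exact Submodule.sum_mem _ fun k _ => Submodule.smul_mem _ _ (Submodule.subset_span ⟨k, rfl⟩)

/-- If `w` does not act trivially on `K` and `∂w/∂x_{j₀} ≠ 0`, the commutators `[w, x_j w x_j⁻¹]`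
with `j ≠ j₀` span `H₁(F; K)`: together with `[w]` they span all chains modulo boundaries, and
since `[w]` has nonzero boundary `φ w - 1` it does not contribute to a cycle. -/
theorem TwistedH1.span_of_commutator_conj {K F ι : Type*} [DivisionRing K] [Group F] [Fintype ι]
    [DecidableEq ι] (b : FreeGroupBasis ι F) {φ : F →* K} {w : F} (hw : φ w ≠ 1)
    (hc : ∀ j, Commute (φ w) (φ (b j * w * (b j)⁻¹))) {j₀ : ι}
    (hj₀ : foxDerivative b φ w j₀ ≠ 0) (h1 : ∀ j, φ ⁅w, b j * w * (b j)⁻¹⁆ = 1) :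
    Submodule.span K ((fun j => TwistedH1.of φ ⁅w, b j * w * (b j)⁻¹⁆ (h1 j)) '' {j | j ≠ j₀}) =
      ⊤ := by
  refine Submodule.span_eq_top_of_coe_mem_span fun z => ?_
  rw [← Set.image_comp]
  have htop := span_commutator_conj_sup_span_eq_top b (isCrossedHom_chainClass φ)
    (span_range_chainClass φ) hw hc hj₀
  obtain ⟨y, hy, v, hv, hyv⟩ := Submodule.mem_sup.1 (htop.ge (Submodule.mem_top (x := z.1)))
  obtain ⟨β, rfl⟩ := Submodule.mem_span_singleton.1 hv
  let d := (LinearMap.range (twistedD₂ φ)).liftQ (twistedD₁ φ)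
    (LinearMap.range_le_ker_iff.2 (twistedD₁_comp_twistedD₂ φ))
  have hd : ∀ s, d (chainClass φ s) = φ s - 1 := by
    intro s
    change twistedD₁ φ (Finsupp.single s 1) = _
    simp [twistedD₁]
  have hdy : y ∈ LinearMap.ker d := by
    refine (Submodule.span_le.2 ?_) hy
    rintro _ ⟨j, _, rfl⟩
    simp only [SetLike.mem_coe, LinearMap.mem_ker]
    rw [hd, h1, sub_self]
  have hdz : d z.1 = 0 := z.2
  rw [← hyv, map_add, LinearMap.mem_ker.1 hdy, zero_add, map_smul, hd, smul_eq_mul,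
    mul_eq_zero, or_iff_left (sub_ne_zero.2 hw)] at hdz
  rw [hdz, zero_smul, add_zero] at hyv
  change (z : (F →₀ K) ⧸ LinearMap.range (twistedD₂ φ)) ∈ _
  rw [← hyv]
  exact hy

end TwistedHomology

/-! ### The coefficient systems `𝕂(G_n)` -/

section Coefficients

variable (R : Type*) [Field R] {F S G : Type*} [Group F] [Group S] [Group G]

theorem toSkewField_injective (n : ℕ) : Function.Injective (toSkewField R G n) :=
  OreLocalization.numeratorHom_inj inf_le_left

theorem toUnitsSkewField_eq_one_iff (n : ℕ) (x : G) :
    toUnitsSkewField R G n x = 1 ↔ x ∈ rationalDerivedSeries G n := by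
  rw [← QuotientGroup.eq_one_iff]
  refine Iff.trans ?_ ((toSkewField_injective R n).comp (MonoidAlgebra.of_injective
    (R := R) (M := G ⧸ rationalDerivedSeries G n))).eq_iff
  rw [Function.comp_apply, Function.comp_apply, map_one, map_one]
  rfl

open scoped commutatorElement in
theorem MonoidHom.commute_map_of_map_commutator_eq_one {A : Type*} [Monoid A] (φ : G →* A) (x y : G)
    (h : φ ⁅x, y⁆ = 1) : Commute (φ x) (φ y) := by
  have : x * y = ⁅x, y⁆ * (y * x) := by simp [commutatorElement_def, mul_assoc]
  rw [Commute, SemiconjBy, ← map_mul, this, map_mul, h, one_mul, map_mul]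

/-- The coefficient system `ℤ G_n`, from which the systems `𝕂_R(G_n)` are obtained for all `R`. -/
noncomputable def toIntGroupRing (G : Type*) [Group G] (n : ℕ) :
    G →* MonoidAlgebra ℤ (G ⧸ rationalDerivedSeries G n) :=
  (MonoidAlgebra.of ℤ _).comp (QuotientGroup.mk' (rationalDerivedSeries G n))

/-- The homomorphism `ℤ G_n → 𝕂_R(G_n)`. -/
noncomputable def intGroupRingToSkewField (G : Type*) [Group G] (n : ℕ) :
    MonoidAlgebra ℤ (G ⧸ rationalDerivedSeries G n) →+* SkewQuotientField R G n :=
  (toSkewField R G n).comp (MonoidAlgebra.mapRingHom _ (Int.castRingHom R))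

theorem intGroupRingToSkewField_toIntGroupRing (n : ℕ) (x : G) :
    intGroupRingToSkewField R G n (toIntGroupRing G n x) = toUnitsSkewField R G n x := by
  simp [intGroupRingToSkewField, toIntGroupRing, toUnitsSkewField, toGroupRing,
    MonoidAlgebra.of_apply]

theorem intGroupRingToSkewField_injective [CharZero R] (n : ℕ) :
    Function.Injective (intGroupRingToSkewField R G n) :=
  (toSkewField_injective R n).comp
    (MonoidAlgebra.map_injective (Int.castRingHom R : ℤ →+ R) Int.cast_injective)

theorem derivedToFieldH1_eq (n : ℕ) (i : F →* S) (r : S →* G) (w : derivedSeries F n)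
    (hw : ((toUnitsSkewField R G n).comp r).comp i w = 1) :
    derivedToFieldH1 R n i r w =
      TwistedH1.mapGroup i ((toUnitsSkewField R G n).comp r) (TwistedH1.of _ (w : F) hw) := by
  rw [derivedToFieldH1, derivedToH1, changeToGn, changeToField, TwistedH1.mapCoeff_of]
  exact (TwistedH1.mapCoeff_of (φ' := (toUnitsSkewField R G n).comp r) _ _ _ _).trans
    (TwistedH1.mapGroup_of i _ _ _).symm

theorem apply_derivedSeries_mem (n : ℕ) (f : F →* G) (w : derivedSeries F n) :
    f w ∈ rationalDerivedSeries G n :=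
  map_mem_rationalDerivedSeries f n _ (derivedSeries_le_rationalDerivedSeries F n w.2)

theorem toUnitsSkewField_comp_comp_derivedSeries (n : ℕ) (i : F →* S) (r : S →* G)
    (w : derivedSeries F n) : ((toUnitsSkewField R G n).comp r).comp i w = 1 :=
  (toUnitsSkewField_eq_one_iff R n _).2 (apply_derivedSeries_mem n (r.comp i) w)

/-- A set of elements of `F^{(n)}` spanning `H₁(F; 𝕂(G_n))` maps to a spanning set of
`H₁(S; 𝕂(G_n))`, as soon as `i` is surjective on homology. -/
theorem span_derivedToFieldH1_eq_top {n : ℕ} {i : F →* S} {r : S →* G}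
    (hsurj : Function.Surjective (TwistedH1.mapGroup i ((toUnitsSkewField R G n).comp r)))
    {T : Set (derivedSeries F n)}
    (hT : Submodule.span (SkewQuotientField R G n)
      ((fun w : derivedSeries F n => TwistedH1.of (((toUnitsSkewField R G n).comp r).comp i) (w : F)
        (toUnitsSkewField_comp_comp_derivedSeries R n i r w)) '' T) = ⊤) :
    Submodule.span (SkewQuotientField R G n) (derivedToFieldH1 R n i r '' T) = ⊤ := by
  have h : derivedToFieldH1 R n i r = TwistedH1.mapGroup i ((toUnitsSkewField R G n).comp r) ∘
      fun w : derivedSeries F n => TwistedH1.of (((toUnitsSkewField R G n).comp r).comp i) (w : F)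
        (toUnitsSkewField_comp_comp_derivedSeries R n i r w) :=
    funext fun w => derivedToFieldH1_eq R n i r w _
  rw [h, Set.image_comp, Submodule.span_image, hT, Submodule.map_top,
    LinearMap.range_eq_top.2 hsurj]

end Coefficients

/-! ### Elements detected by rational homology -/

section Detection

/-- The map `G_r^{(n)} → H₁(G; A)` for a coefficient system on which `G_r^{(n)}` acts trivially
factors, `A` being of characteristic zero, through `G_r^{(n)} / G_r^{(n+1)}`. -/
theorem TwistedH1.of_eq_zero_of_mem_rationalDerivedSeries_succ {G A : Type*} [Group G]
    [DivisionRing A] [CharZero A] {n : ℕ} {φ : G →* A}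
    (hφ : ∀ x ∈ rationalDerivedSeries G n, φ x = 1) {x : G}
    (hx : x ∈ rationalDerivedSeries G (n + 1)) (h1 : φ x = 1) : TwistedH1.of φ x h1 = 0 := by
  obtain ⟨hxn, m, hm, hxm⟩ := mem_rationalDerivedSeries_succ.1 hx
  let q : rationalDerivedSeries G n →*
      Multiplicative ((G →₀ A) ⧸ LinearMap.range (twistedD₂ φ)) :=
    { toFun := fun y => Multiplicative.ofAdd (chainClass φ y)
      map_one' := (isCrossedHom_chainClass φ).map_one
      map_mul' := fun y z => by
        rw [Subgroup.coe_mul, isCrossedHom_chainClass φ y z, hφ y y.2, one_smul]; rfl }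
  have hker : ⁅rationalDerivedSeries G n, rationalDerivedSeries G n⁆ ≤
      q.ker.map (rationalDerivedSeries G n).subtype := by
    rw [← Subgroup.map_subtype_commutator]
    exact Subgroup.map_mono (Abelianization.commutator_subset_ker q)
  obtain ⟨y, hy, hyx⟩ := hker hxm
  have hyx' : y = (⟨x, hxn⟩ : rationalDerivedSeries G n) ^ m := Subtype.ext hyx
  have hq : m • chainClass φ x = 0 := by
    have h2 : q (⟨x, hxn⟩ ^ m) = 1 := hyx' ▸ hy
    rw [map_pow] at h2
    exact h2
  refine Subtype.ext ?_
  rw [TwistedH1.coe_of]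
  rw [← Nat.cast_smul_eq_nsmul A] at hq
  exact (smul_eq_zero.1 hq).resolve_left (Nat.cast_ne_zero.2 hm.ne')

/-- If `r_*` is nonzero on `H₁(-; 𝕂(G_n))`, a spanning set contains an element whose image in `G`
survives in `G_{n+1}`. -/
theorem exists_notMem_rationalDerivedSeries_succ {F S G : Type*} [Group F] [Group S] [Group G]
    {n : ℕ} {i : F →* S} {r : S →* G} {T : Set (derivedSeries F n)}
    (hT : Submodule.span (SkewQuotientField ℚ G n) (derivedToFieldH1 ℚ n i r '' T) = ⊤)
    (hr : TwistedH1.mapGroup r (toUnitsSkewField ℚ G n) ≠ 0) :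
    ∃ w ∈ T, r (i w) ∉ rationalDerivedSeries G (n + 1) := by
  by_contra! h
  have : CharZero (SkewQuotientField ℚ G n) :=
    charZero_of_injective_ringHom
      ((toSkewField ℚ G n).comp MonoidAlgebra.singleOneRingHom).injective
  refine hr (LinearMap.ext_on hT ?_)
  rintro _ ⟨w, hw, rfl⟩
  rw [derivedToFieldH1_eq ℚ n i r w (toUnitsSkewField_comp_comp_derivedSeries ℚ n i r w),
    TwistedH1.mapGroup_of, TwistedH1.mapGroup_of]
  exact TwistedH1.of_eq_zero_of_mem_rationalDerivedSeries_succ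
    (fun x hx => (toUnitsSkewField_eq_one_iff ℚ n x).2 hx) (h w hw) _

end Detection

/-! ### The collections of commutators -/

section Collections

open scoped commutatorElement

variable {F ι : Type*} [Group F]

/-- The element `[w, x w x⁻¹]` of `F^{(n+1)}`, for `w` in `F^{(n)}`. -/
def commutatorConj {n : ℕ} (w : derivedSeries F n) (x : F) : derivedSeries F (n + 1) :=
  ⟨⁅(w : F), x * w * x⁻¹⁆, Subgroup.commutator_mem_commutator w.2
    ((derivedSeries_normal F n).conj_mem _ w.2 x)⟩

theorem IsAlgebraicSolution.of_succ {R S G : Type*} [Field R] [Group S] [Group G] {n : ℕ}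
    {i : F →* S} {r : S →* G} (h : IsAlgebraicSolution R (n + 1) i r) :
    IsAlgebraicSolution R n i r :=
  ⟨h.nontrivial_H1, h.ne_one, fun k hk => h.map_ne_zero k (hk.trans n.lt_succ_self),
    fun k hk => h.map_surjective k (hk.trans n.le_succ)⟩

variable [Fintype ι] [DecidableEq ι] (b : FreeGroupBasis ι F) {S G : Type*} [Group S] [Group G]
  (R : Type*) [Field R] {n : ℕ} {i : F →* S} {r : S →* G} {w : derivedSeries F n}

theorem commute_toUnitsSkewField_conj (w : derivedSeries F n) (x : F) :
    Commute (((toUnitsSkewField R G (n + 1)).comp r).comp i w)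
      (((toUnitsSkewField R G (n + 1)).comp r).comp i (x * w * x⁻¹)) :=
  MonoidHom.commute_map_of_map_commutator_eq_one _ _ _
    (toUnitsSkewField_comp_comp_derivedSeries R (n + 1) i r (commutatorConj w x))

theorem span_derivedToFieldH1_commutatorConj
    (hw : r (i w) ∉ rationalDerivedSeries G (n + 1)) {j₀ : ι}
    (hj₀ : foxDerivative b (((toUnitsSkewField R G (n + 1)).comp r).comp i) w j₀ ≠ 0)
    (hsurj : Function.Surjective (TwistedH1.mapGroup i ((toUnitsSkewField R G (n + 1)).comp r))) :
    Submodule.span (SkewQuotientField R G (n + 1))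
      (derivedToFieldH1 R (n + 1) i r '' ((fun j => commutatorConj w (b j)) '' {j | j ≠ j₀})) =
        ⊤ := by
  refine span_derivedToFieldH1_eq_top R hsurj ?_
  rw [← Set.image_comp]
  exact TwistedH1.span_of_commutator_conj b
    (fun h => hw ((toUnitsSkewField_eq_one_iff R (n + 1) _).1 h))
    (fun j => commute_toUnitsSkewField_conj R w (b j)) hj₀
    fun j => toUnitsSkewField_comp_comp_derivedSeries R (n + 1) i r (commutatorConj w (b j))

end Collections

theorem theorem5p10 {F : Type*} [Group F] {S : Type*} [Group S] (g : ℕ)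
    (hF : Nonempty (FreeGroupBasis (Fin (2 * g)) F)) (i : F →* S) (n : ℕ) :
    ∃ P : Finset (Finset (derivedSeries F n)),
      (∀ T ∈ P, T.card = if n = 0 then 2 * g else 2 * g - 1) ∧
      ∀ (p : ℕ) [Fact p.Prime] (G : Type*) [Group G] (r : S →* G),
        IsAlgebraicSolution ℚ n i r → IsAlgebraicSolution (ZMod p) n i r →
        ∃ T ∈ P,
          Submodule.span (SkewQuotientField ℚ G n)
            (derivedToFieldH1 ℚ n i r '' (T : Set (derivedSeries F n))) = ⊤ ∧
          Submodule.span (SkewQuotientField (ZMod p) G n)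
            (derivedToFieldH1 (ZMod p) n i r '' (T : Set (derivedSeries F n))) = ⊤ := by
  classical
  obtain ⟨b⟩ := hF
  induction n with
  | zero =>
    let T : Finset (derivedSeries F 0) := Finset.univ.image fun j => ⟨b j, Subgroup.mem_top _⟩
    refine ⟨{T}, ?_, ?_⟩
    · intro T' hT'
      rw [Finset.mem_singleton.1 hT', if_pos rfl, Finset.card_image_of_injective, Finset.card_univ,
        Fintype.card_fin]
      intro j k hjk
      exact b.injective (Subtype.ext_iff.1 hjk)
    · intro p _ G _ r hQ hp
      have key : ∀ (R : Type) [Field R], IsAlgebraicSolution R 0 i r →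
          Submodule.span (SkewQuotientField R G 0)
            (derivedToFieldH1 R 0 i r '' (T : Set (derivedSeries F 0))) = ⊤ := by
        intro R _ hR
        refine span_derivedToFieldH1_eq_top R (hR.map_surjective 0 le_rfl) ?_
        rw [Finset.coe_image, ← Set.image_comp, Finset.coe_univ, Set.image_univ]
        exact TwistedH1.span_of_basis b (((toUnitsSkewField R G 0).comp r).comp i) fun s =>
          toUnitsSkewField_comp_comp_derivedSeries R 0 i r ⟨s, Subgroup.mem_top s⟩
      exact ⟨T, Finset.mem_singleton_self T, key ℚ hQ, key (ZMod p) hp⟩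
  | succ n ih =>
    obtain ⟨P, -, hP⟩ := ih
    let C : derivedSeries F n × Fin (2 * g) → Finset (derivedSeries F (n + 1)) := fun x =>
      (Finset.univ.erase x.2).image fun j => commutatorConj x.1 (b j)
    -- The filter discards degenerate sets, such as those for `w = 1`; a set that is used below has
    -- pairwise distinct commutators.
    refine ⟨((P.biUnion id ×ˢ Finset.univ).image C).filter fun T => T.card = 2 * g - 1, ?_, ?_⟩
    · intro T hT
      rw [if_neg n.succ_ne_zero]
      exact (Finset.mem_filter.1 hT).2
    · intro p _ G _ r hQ hp
      obtain ⟨T, hTP, hTQ, -⟩ := hP p G r hQ.of_succ hp.of_succ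
      obtain ⟨w, hwT, hw⟩ := exists_notMem_rationalDerivedSeries_succ hTQ
        (hQ.map_ne_zero n n.lt_succ_self)
      have hw1 : ∀ (R : Type) [Field R],
          ((toUnitsSkewField R G (n + 1)).comp r).comp i w ≠ 1 := fun R _ h =>
        hw ((toUnitsSkewField_eq_one_iff R (n + 1) _).1 h)
      obtain ⟨j₀, hjp⟩ := exists_foxDerivative_ne_zero b _ (hw1 (ZMod p))
      have hfox : ∀ (R : Type) [Field R], intGroupRingToSkewField R G (n + 1)
          (foxDerivative b (((toIntGroupRing G (n + 1)).comp r).comp i) w j₀) =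
            foxDerivative b (((toUnitsSkewField R G (n + 1)).comp r).comp i) w j₀ := fun R _ =>
        foxDerivative_map b _ _ _
          (fun s => intGroupRingToSkewField_toIntGroupRing R (n + 1) (r (i s))) w j₀
      -- A Fox derivative in `ℤ G_{n+1}` which is nonzero mod `p` is nonzero, hence nonzero over `ℚ`.
      have hjQ : foxDerivative b (((toUnitsSkewField ℚ G (n + 1)).comp r).comp i) w j₀ ≠ 0 := by
        rw [← hfox ℚ]
        refine fun h => hjp ?_
        rw [← hfox (ZMod p), (injective_iff_map_eq_zero _).1
          (intGroupRingToSkewField_injective ℚ (n + 1)) _ h, map_zero]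
      have hCset : (C (w, j₀) : Set (derivedSeries F (n + 1))) =
          (fun j => commutatorConj w (b j)) '' {j | j ≠ j₀} := by
        rw [Finset.coe_image, Finset.coe_erase, Finset.coe_univ]
        congr 1
        ext j
        simp
      refine ⟨C (w, j₀), Finset.mem_filter.2 ⟨Finset.mem_image_of_mem C (Finset.mem_product.2
        ⟨Finset.mem_biUnion.2 ⟨T, hTP, hwT⟩, Finset.mem_univ _⟩), ?_⟩, ?_, ?_⟩
      · rw [Finset.card_image_of_injOn, Finset.card_erase_of_mem (Finset.mem_univ _),
          Finset.card_univ, Fintype.card_fin]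
        intro j hj k hk hjk
        exact injOn_commutator_conj b (hw1 ℚ) (fun j => commute_toUnitsSkewField_conj ℚ w (b j)) hjQ
          (Finset.ne_of_mem_erase hj) (Finset.ne_of_mem_erase hk) (Subtype.ext_iff.1 hjk)
      · rw [hCset]
        exact span_derivedToFieldH1_commutatorConj b ℚ hw hjQ (hQ.map_surjective _ le_rfl)
      · rw [hCset]
        exact span_derivedToFieldH1_commutatorConj b (ZMod p) hw hjp (hp.map_surjective _ le_rfl)
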